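/- Let $X$ be a Hausdorff (equivalently, Tychonoff) topological group. Let $F(X)$ and $A(X)$ be, respectively, the free topological group and the free Abelian topological group in the sense of Markov over the topological space underlying $X$, i.e. the free group and the free Abelian group on the set $X$, each with the finest group topology for which the inclusion of $X$ is continuous. Then $$F(X)\text{ is }snf\text{-countable}\iff X\text{ contains no non-trivial convergent sequence},$$ $$A(X)\text{ is }snf\text{-countable}\iff X\text{ contains no non-trivial convergent sequence}.$$ Here a convergent sequence is non-trivial if it is not eventually constant. A subset $P$ of a space $Y$ is a sequential neighborhood of $y\in Y$ if every sequence in $Y$ converging to $y$ is eventually in $P$. The space $Y$ is $snf$-countable if it has a cover $\mathscr P=\bigcup_{y\in Y}\mathscr P_y$ by subsets such that, for every $y\in Y$: $\mathscr P_y$ is countable; every element of $\mathscr P_y$ is a sequential neighborhood of $y$; for all $U,V\in\mathscr P_y$ there is $W\in\mathscr P_y$ with $W\subseteq U\cap V$; and for every open neighborhood $U$ of $y$ there is $P\in\mathscr P_y$ with $y\in P\subseteq U$. -/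

import Mathlib

open Filter Topology

/-- The topology of the free topological group `F(X)` on the free group over `X`: the finest
group topology for which the inclusion of generators is continuous. -/
instance FreeGroup.markovTopology (X : Type*) [TopologicalSpace X] :
    TopologicalSpace (FreeGroup X) :=
  (GroupTopology.coinduced (FreeGroup.of : X → FreeGroup X)).toTopologicalSpace

instance FreeGroup.markovIsTopologicalGroup (X : Type*) [TopologicalSpace X] :
    IsTopologicalGroup (FreeGroup X) :=
  (GroupTopology.coinduced (FreeGroup.of : X → FreeGroup X)).toIsTopologicalGroup

/-- The topology of the free Abelian topological group `A(X)` on the free Abelian group over `X`: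
the finest group topology for which the inclusion of generators is continuous. -/
instance FreeAbelianGroup.markovTopology (X : Type*) [TopologicalSpace X] :
    TopologicalSpace (FreeAbelianGroup X) :=
  (AddGroupTopology.coinduced (FreeAbelianGroup.of : X → FreeAbelianGroup X)).toTopologicalSpace

instance FreeAbelianGroup.markovIsTopologicalAddGroup (X : Type*) [TopologicalSpace X] :
    IsTopologicalAddGroup (FreeAbelianGroup X) :=
  (AddGroupTopology.coinduced (FreeAbelianGroup.of : X → FreeAbelianGroup X)).toIsTopologicalAddGroup

/-- `P` is a sequential neighborhood of `x`: every sequence converging to `x` is eventually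
in `P`. -/
def IsSequentialNhd {Y : Type*} [TopologicalSpace Y] (x : Y) (P : Set Y) : Prop :=
  ∀ u : ℕ → Y, Tendsto u atTop (𝓝 x) → ∀ᶠ n in atTop, u n ∈ P

/-- The family `⋃ x, N x`, with its decomposition into the families `N x`, is an `sn`-network. -/
structure IsSnNetwork {Y : Type*} [TopologicalSpace Y] (N : Y → Set (Set Y)) : Prop where
  cover : ⋃₀ (⋃ x, N x) = Set.univ
  inter : ∀ x, ∀ U ∈ N x, ∀ V ∈ N x, ∃ W ∈ N x, W ⊆ U ∩ V
  network : ∀ x, ∀ U : Set Y, IsOpen U → x ∈ U → ∃ P ∈ N x, x ∈ P ∧ P ⊆ U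
  sequentialNhd : ∀ x, ∀ P ∈ N x, IsSequentialNhd x P

/-- A space is `snf`-countable if it has an `sn`-network that is countable at every point. -/
def SnfCountable (Y : Type*) [TopologicalSpace Y] : Prop :=
  ∃ N : Y → Set (Set Y), IsSnNetwork N ∧ ∀ x, (N x).Countable

/-- The space contains a non-trivial convergent sequence, that is, a convergent sequence which is
not eventually constant. -/
def HasNontrivialConvergentSequence (Y : Type*) [TopologicalSpace Y] : Prop :=
  ∃ (u : ℕ → Y) (x : Y), Tendsto u atTop (𝓝 x) ∧ ¬ ∃ c : Y, ∀ᶠ n in atTop, u n = c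

/-!
Both equivalences reduce to sequences. Write `G` for `F(X)` or `A(X)`.

Suppose that `X` has no nontrivial convergent sequence. Then `G` has none either, so that all
singletons of `G` are sequential neighborhoods and `G` is `snf`-countable. Indeed, let `g k` converge
to the identity of `G` with all `g k` nontrivial. Two facts are combined.

* For each neighborhood `W` of `1` in `X`, eventually `g k` has two distinct letters `x`, `y` with
  `x⁻¹ * y ∈ W`. Otherwise the letters of `g k` are separated by bump functions, and a homomorphism
  to a group of step functions, in the style of Hartman and Mycielski, keeps `g k` away from the
  identity (`exists_pseudonorm_separated`). This works in every variety of groups, and it also shows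
  that `F(X)` is Hausdorff.
* The number of letters of `g k` is bounded. For `A(X)` this is the Banach–Steinhaus theorem: the
  `g k` are integral combinations of point masses which tend to zero weakly on a Banach space of
  bounded functions on `X`, and their norms as functionals are the sums of the absolute values of the
  coefficients (`exists_bound_of_weakly_tendsto`). For `F(X)` the same theorem is applied to the Fox
  derivatives of the `g k`, that is, to the edge paths from `1` to `g k` in the Cayley graph. Such a
  chain of edges is a cocycle for the translation action of `F(X)`, hence depends continuously on the
  element when it is tested on uniformly continuous functions on `F(X) × X`
  (`FreeGroup.tendsto_chainPairing_fox`), and it has an edge for each letter of the element since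
  the path of a reduced word does not repeat edges (`FreeGroup.fox_mk_of_isReduced`).

So the elements `x⁻¹ * y`, for distinct letters `x`, `y` of `g k`, form finite sets of bounded
cardinality which do not contain `1` and meet each neighborhood of `1` eventually. Removing points one
at a time along subsequences, one finds a nontrivial sequence in `X` converging to `1`
(`false_of_finset_tendsto_one`). This is where the group structure of `X` enters: in a general
Tychonoff space the differences of two sequences could tend to zero in `A(X)` although neither of the
sequences has a convergent subsequence.

Conversely, let `u k` converge to `x` in `X`, with `u k ≠ x` for infinitely many `k`. For each `m` the
elements `m • (u k - x)` converge to zero in `A(X)`. If `A(X)` were `snf`-countable, a diagonal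
sequence `m • (u (κ m) - x)` would converge to zero, but its lengths are not bounded. The argument for
`F(X)` uses the powers of `u k * x⁻¹` and the continuous homomorphism from `F(X)` to `A(X)`.
-/

/-! ### Left uniformly continuous bump functions -/

open scoped Uniformity SetRel in
/-- Every neighborhood of `1` in a topological group contains the support of a bump function
which is uniformly continuous for the left uniformity. -/
theorem exists_leftUniform_bump {T : Type*} [Group T] [TopologicalSpace T] [IsTopologicalGroup T]
    {W : Set T} (hW : W ∈ 𝓝 (1 : T)) :
    ∃ ψ : T → ℝ, ψ 1 = 1 ∧ (∀ a, a ∉ W → ψ a = 0) ∧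
      ∀ ε > 0, ∀ᶠ v in 𝓝 (1 : T), ∀ a, |ψ (a * v) - ψ a| < ε := by
  have step : ∀ U : {U : Set T // U ∈ 𝓝 (1 : T)}, ∃ V : {V : Set T // V ∈ 𝓝 (1 : T)},
      (∀ a ∈ V.1, a⁻¹ ∈ U.1) ∧ ∀ a ∈ V.1, ∀ b ∈ V.1, a * b ∈ U.1 := by
    rintro ⟨U, hU⟩
    obtain ⟨V, hV, hVm⟩ := exists_nhds_one_split hU
    exact ⟨⟨V ∩ U⁻¹, inter_mem hV (inv_mem_nhds_one T hU)⟩, fun a ha ↦ ha.2,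
      fun a ha b hb ↦ hVm a ha.1 b hb.1⟩
  choose next hinv hmul using step
  let V : ℕ → {V : Set T // V ∈ 𝓝 (1 : T)} := fun n ↦ next^[n] ⟨W, hW⟩
  have hVs : ∀ n, V (n + 1) = next (V n) := fun n ↦ Function.iterate_succ_apply' _ _ _
  have hanti : Antitone fun n ↦ (V n).1 := by
    refine antitone_nat_of_succ_le fun n a ha ↦ ?_
    rw [hVs] at ha
    have := hmul _ a ha 1 (mem_of_mem_nhds (next (V n)).2)
    rwa [mul_one] at this
  let 𝓕 : Filter T := ⨅ n, 𝓟 (V n).1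
  have hbasis : 𝓕.HasAntitoneBasis fun n ↦ (V n).1 := HasAntitoneBasis.iInf_principal hanti
  -- The coarser, countably generated, left invariant uniformity defined by the sets `V n`.
  let u : UniformSpace T := .ofCore
    { uniformity := comap (fun p : T × T ↦ p.1⁻¹ * p.2) 𝓕
      refl := by
        rw [(hbasis.1.comap _).ge_iff]
        rintro n - ⟨a, b⟩ hab
        have hab : a = b := hab
        simpa [hab] using mem_of_mem_nhds (V n).2
      symm := by
        rw [tendsto_comap_iff, hbasis.1.tendsto_right_iff]
        intro n _
        refine mem_of_superset (preimage_mem_comap (hbasis.1.mem_of_mem (i := n + 1) trivial)) ?_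
        rintro ⟨a, b⟩ hab
        have hab : a⁻¹ * b ∈ (V (n + 1)).1 := hab
        rw [hVs] at hab
        simpa using hinv _ _ hab
      comp := by
        rw [(hbasis.1.comap _).ge_iff]
        intro n _
        refine mem_of_superset (mem_lift'
          (preimage_mem_comap (hbasis.1.mem_of_mem (i := n + 1) trivial))) ?_
        rintro ⟨a, b⟩ ⟨c, hac, hcb⟩
        have hac : a⁻¹ * c ∈ (V (n + 1)).1 := hac
        have hcb : c⁻¹ * b ∈ (V (n + 1)).1 := hcb
        rw [hVs] at hac hcb
        simpa [mul_assoc] using hmul _ _ hac _ hcb }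
  have hu : 𝓤[u] = comap (fun p : T × T ↦ p.1⁻¹ * p.2) 𝓕 := rfl
  have : IsCountablyGenerated 𝓤[u] := by
    have := hbasis.isCountablyGenerated
    rw [hu]; infer_instance
  let m : PseudoMetricSpace T := @UniformSpace.pseudoMetricSpace T u this
  have hm : 𝓤[m.toUniformSpace] = comap (fun p : T × T ↦ p.1⁻¹ * p.2) 𝓕 := rfl
  have hent : ∀ n, {p : T × T | p.1⁻¹ * p.2 ∈ (V n).1} ∈ 𝓤[m.toUniformSpace] := fun n ↦ by
    rw [hm]
    exact preimage_mem_comap (hbasis.1.mem_of_mem trivial)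
  obtain ⟨δ, hδ, hδW⟩ := Metric.mem_uniformity_dist.1 (hent 0)
  refine ⟨fun a ↦ max 0 (1 - dist 1 a / δ), by simp, fun a ha ↦ ?_, fun ε hε ↦ ?_⟩
  · refine max_eq_left (sub_nonpos.2 ((one_le_div hδ).2 (not_lt.1 fun h ↦ ha ?_)))
    have h0 : (1 : T)⁻¹ * a ∈ (V 0).1 := hδW h
    rwa [inv_one, one_mul] at h0
  · have hε' : {p : T × T | dist p.1 p.2 < ε * δ} ∈ 𝓤[m.toUniformSpace] :=
      Metric.dist_mem_uniformity (by positivity)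
    rw [hm, (hbasis.1.comap _).mem_iff] at hε'
    obtain ⟨n, -, hn⟩ := hε'
    filter_upwards [(V n).2] with v hv a
    have h1 : dist a (a * v) < ε * δ :=
      @hn (a, a * v) (show a⁻¹ * (a * v) ∈ (V n).1 by rwa [inv_mul_cancel_left])
    calc |max 0 (1 - dist 1 (a * v) / δ) - max 0 (1 - dist 1 a / δ)|
        ≤ |(1 - dist 1 (a * v) / δ) - (1 - dist 1 a / δ)| := by
          rw [max_comm 0, max_comm 0]; exact abs_max_sub_max_le_abs _ _ _
      _ = |dist 1 a - dist 1 (a * v)| / δ := by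
          rw [← abs_of_pos hδ, ← abs_div, abs_of_pos hδ]; congr 1; ring
      _ ≤ dist a (a * v) / δ := by
          gcongr
          rw [dist_comm 1 a, dist_comm 1 (a * v)]
          exact abs_dist_sub_le _ _ _
      _ < ε := (div_lt_iff₀ hδ).2 h1

/-! ### Pseudonorms continuous for the finest group topology -/

/-- A sufficient condition for a pseudonorm to be continuous at `1` for the finest group topology
making `i` continuous. The hypothesis on conjugation is weaker than conjugation invariance: it
is only required that conjugation by a fixed element is continuous at `1` for the topology
generated by the pseudonorm and the finest topology. -/
@[to_additive /-- A sufficient condition for a pseudonorm to be continuous at `0` for the finest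
additive group topology making `i` continuous. -/]
theorem GroupTopology.tendsto_pseudonorm_coinduced {X G : Type*} [TopologicalSpace X] [Group G]
    (i : X → G) (p : G → ENNReal) (p_one : p 1 = 0) (p_mul : ∀ g h, p (g * h) ≤ p g + p h)
    (p_inv : ∀ g, p g⁻¹ = p g)
    (p_conj : ∀ h, ∀ ε > 0, ∃ δ > 0,
      ∃ V ∈ @nhds G (GroupTopology.coinduced i).toTopologicalSpace 1,
      ∀ g ∈ V, p g < δ → p (h * g * h⁻¹) < ε)
    (p_cont : ∀ x, Tendsto (fun y ↦ p ((i x)⁻¹ * i y)) (𝓝 x) (𝓝 0)) :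
    Tendsto p (@nhds G (GroupTopology.coinduced i).toTopologicalSpace 1) (𝓝 0) := by
  let tG : TopologicalSpace G := (GroupTopology.coinduced i).toTopologicalSpace
  have : IsTopologicalGroup G := (GroupTopology.coinduced i).toIsTopologicalGroup
  have hi : Continuous i := GroupTopology.coinduced_continuous i
  let B : GroupFilterBasis G :=
    { sets := {S | ∃ V ∈ 𝓝 (1 : G), ∃ ε > 0, S = {g | g ∈ V ∧ p g < ε}}
      nonempty := ⟨_, Set.univ, univ_mem, 1, one_pos, rfl⟩
      inter_sets := by
        rintro _ _ ⟨V, hV, ε, hε, rfl⟩ ⟨V', hV', ε', hε', rfl⟩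
        refine ⟨_, ⟨V ∩ V', inter_mem hV hV', min ε ε', lt_min hε hε', rfl⟩, ?_⟩
        rintro g ⟨hg, hpg⟩
        exact ⟨⟨hg.1, (lt_min_iff.1 hpg).1⟩, ⟨hg.2, (lt_min_iff.1 hpg).2⟩⟩
      one' := by
        rintro _ ⟨V, hV, ε, hε, rfl⟩
        exact ⟨mem_of_mem_nhds hV, p_one.trans_lt hε⟩
      mul' := by
        rintro _ ⟨V, hV, ε, hε, rfl⟩
        obtain ⟨U, hU, hUV⟩ := exists_nhds_one_split hV
        refine ⟨_, ⟨U, hU, ε / 2, ENNReal.half_pos hε.ne', rfl⟩, ?_⟩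
        rintro _ ⟨g, hg, h, hh, rfl⟩
        refine ⟨hUV g hg.1 h hh.1, (p_mul g h).trans_lt ?_⟩
        rw [← ENNReal.add_halves ε]
        exact ENNReal.add_lt_add hg.2 hh.2
      inv' := by
        rintro _ ⟨V, hV, ε, hε, rfl⟩
        refine ⟨_, ⟨V⁻¹, inv_mem_nhds_one G hV, ε, hε, rfl⟩, ?_⟩
        rintro g ⟨hg, hpg⟩
        exact ⟨hg, (p_inv g).trans_lt hpg⟩
      conj' := by
        rintro h _ ⟨V, hV, ε, hε, rfl⟩
        obtain ⟨δ, hδ, U, hU, hUV⟩ := p_conj h ε hε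
        have hc : Tendsto (fun g ↦ h * g * h⁻¹) (𝓝 1) (𝓝 1) := by
          have : Continuous fun g : G ↦ h * g * h⁻¹ := by fun_prop
          simpa using this.tendsto 1
        refine ⟨_, ⟨U ∩ _, inter_mem hU (hc hV), δ, hδ, rfl⟩, ?_⟩
        rintro g ⟨hg, hpg⟩
        exact ⟨hg.2, hUV g hg.1 hpg⟩ }
  have hle : (GroupTopology.coinduced i) ≤
      @GroupTopology.mk G _ B.topology B.isTopologicalGroup := by
    refine sInf_le ?_
    show TopologicalSpace.coinduced i _ ≤ B.topology
    rw [← continuous_iff_coinduced_le, @continuous_iff_continuousAt _ _ _ B.topology]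
    intro x
    show Tendsto _ _ (@nhds G B.topology (i x))
    rw [(B.nhds_hasBasis (i x)).tendsto_right_iff]
    rintro _ ⟨V, hV, ε, hε, rfl⟩
    have h1 : Tendsto (fun y ↦ (i x)⁻¹ * i y) (𝓝 x) (𝓝 1) := by
      have : Continuous fun y ↦ (i x)⁻¹ * i y := by fun_prop
      simpa using this.tendsto x
    filter_upwards [h1 hV, (p_cont x).eventually (gt_mem_nhds hε)] with y hy hpy
    exact ⟨_, ⟨hy, hpy⟩, by simp⟩
  have hnhds : 𝓝 (1 : G) ≤ @nhds G B.topology 1 := nhds_mono hle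
  refine Tendsto.mono_left ?_ hnhds
  rw [ENNReal.tendsto_nhds_zero]
  intro ε hε
  refine mem_of_superset (B.mem_nhds_one ⟨Set.univ, univ_mem, ε, hε, rfl⟩) ?_
  rintro g ⟨-, hg⟩
  exact hg.le

/-! ### Elements with separated letters -/

theorem ENNReal.exists_pos_ofReal_le {ε : ENNReal} (hε : 0 < ε) :
    ∃ δ : ℝ, 0 < δ ∧ ENNReal.ofReal δ ≤ ε := by
  rcases eq_or_ne ε ⊤ with rfl | h
  · exact ⟨1, one_pos, le_top⟩
  · exact ⟨ε.toReal, ENNReal.toReal_pos hε.ne' h, by rw [ENNReal.ofReal_toReal h]⟩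

open Classical MeasureTheory in
/-- A conjugation invariant pseudonorm on a group generated freely (in some variety of groups) by
`i`, continuous along `i`, and at least `1` at each nontrivial element with a `W`-separated set of
letters. It is obtained from the Hartman–Mycielski group of step functions `[0, 1) → G`: for a
`W`-separated set `S`, a letter `y` is sent to the step function with value `i x` on
`[0, ψ (x⁻¹ * y))`, where `x` is the point of `S` close to `y` and `ψ` is a bump function, and with
value `1` elsewhere; then the norm of `g` is the measure of the support of its image, maximized
over `S`. -/
theorem exists_pseudonorm_separated {X G : Type*} [Group X] [TopologicalSpace X]
    [IsTopologicalGroup X] [Group G] (i : X → G)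
    (hlift : ∀ r : X → G, ∃ φ : G →* G, ∀ x, φ (i x) = r x) {W : Set X} (hW : W ∈ 𝓝 (1 : X)) :
    ∃ p : G → ENNReal, p 1 = 0 ∧ (∀ g h, p (g * h) ≤ p g + p h) ∧ (∀ g, p g⁻¹ = p g) ∧
      (∀ h g, p (h * g * h⁻¹) = p g) ∧
      (∀ x, Tendsto (fun y ↦ p ((i x)⁻¹ * i y)) (𝓝 x) (𝓝 0)) ∧
      ∀ S : Set X, (∀ x ∈ S, ∀ y ∈ S, x ≠ y → x⁻¹ * y ∉ W) →
        ∀ g ∈ Subgroup.closure (i '' S), g ≠ 1 → 1 ≤ p g := by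
  obtain ⟨U, hU, hUW⟩ := exists_nhds_split_inv hW
  obtain ⟨V, hV, hVU⟩ := exists_nhds_one_split hU
  obtain ⟨ψ, ψ_one, ψ_supp, ψ_unif⟩ :=
    exists_leftUniform_bump (inter_mem hV hU)
  let 𝒮 := {S : Set X // ∀ x ∈ S, ∀ y ∈ S, x ≠ y → x⁻¹ * y ∉ W}
  -- At most one point of a separated set is close to `y` or to `y * v`.
  have huniq : ∀ S : 𝒮, ∀ x ∈ S.1, ∀ x' ∈ S.1, ∀ y, ∀ v ∈ V, ψ (x⁻¹ * y) ≠ 0 →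
      ψ (x'⁻¹ * (y * v)) ≠ 0 → x = x' := by
    intro S x hx x' hx' y v hv h h'
    by_contra hne
    have h1 : x⁻¹ * y ∈ V := (by_contra fun hn ↦ h (ψ_supp _ hn) : _ ∈ V ∩ U).1
    have h2 : x'⁻¹ * (y * v) ∈ U := (by_contra fun hn ↦ h' (ψ_supp _ hn) : _ ∈ V ∩ U).2
    refine S.2 x hx x' hx' hne ?_
    convert hUW _ (hVU _ h1 _ hv) _ h2 using 1
    simp [div_eq_mul_inv, mul_assoc]
  let r : Set X → ℝ → X → G := fun S t y ↦
    if h : ∃ x ∈ S, t < ψ (x⁻¹ * y) then i h.choose else 1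
  have r_eq : ∀ (S : Set X) (t : ℝ) (x z : X), x ∈ S → 0 ≤ t →
      (∀ x' ∈ S, ψ (x'⁻¹ * z) ≠ 0 → x' = x) →
      r S t z = if t < ψ (x⁻¹ * z) then i x else 1 := by
    intro S t x z hx ht hu
    have hx' : ∀ x' ∈ S, t < ψ (x'⁻¹ * z) → x' = x :=
      fun x' h h' ↦ hu x' h (ht.trans_lt h').ne'
    by_cases h : t < ψ (x⁻¹ * z)
    · have hex : ∃ x ∈ S, t < ψ (x⁻¹ * z) := ⟨x, hx, h⟩
      simp only [r, dif_pos hex, if_pos h]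
      rw [hx' _ hex.choose_spec.1 hex.choose_spec.2]
    · have hex : ¬ ∃ x ∈ S, t < ψ (x⁻¹ * z) := by
        rintro ⟨x', h1, h2⟩
        exact h (hx' x' h1 h2 ▸ h2)
      simp only [r, dif_neg hex, if_neg h]
  choose φ hφ using fun (S : Set X) (t : ℝ) ↦ hlift (r S t)
  let N : 𝒮 → G → ENNReal := fun S g ↦ volume {t : ℝ | t ∈ Set.Ico 0 1 ∧ φ S.1 t g ≠ 1}
  have N_le : ∀ S g, N S g ≤ ⨆ S, N S g := fun S g ↦ le_iSup (fun S ↦ N S g) S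
  refine ⟨fun g ↦ ⨆ S, N S g, ?_, fun g h ↦ iSup_le fun S ↦ ?_, fun g ↦ ?_, fun h g ↦ ?_,
    fun x ↦ ?_, fun S hS g hg hg1 ↦ ?_⟩
  · simp [N]
  · refine (measure_mono ?_).trans ((measure_union_le _ _).trans (add_le_add (N_le S g) (N_le S h)))
    rintro t ⟨ht, hne⟩
    by_cases h1 : φ S.1 t g = 1
    · refine Or.inr ⟨ht, fun h2 ↦ hne ?_⟩
      rw [map_mul, h1, h2, one_mul]
    · exact Or.inl ⟨ht, h1⟩
  · simp [N]
  · simp [N, map_mul]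
  · rw [ENNReal.tendsto_nhds_zero]
    intro ε hε
    obtain ⟨δ, hδ, hδε⟩ := ENNReal.exists_pos_ofReal_le hε
    have hev : ∀ᶠ v in 𝓝 (1 : X), v ∈ V ∧ ∀ a, |ψ (a * v) - ψ a| < δ :=
      (eventually_mem_set.2 hV).and (ψ_unif δ hδ)
    have ht : Tendsto (fun y ↦ x⁻¹ * y) (𝓝 x) (𝓝 1) := by
      have : Continuous fun y ↦ x⁻¹ * y := by fun_prop
      simpa using this.tendsto x
    filter_upwards [ht.eventually hev] with y ⟨hyV, hyψ⟩
    obtain ⟨v, rfl⟩ : ∃ v, y = x * v := ⟨x⁻¹ * y, by simp⟩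
    rw [inv_mul_cancel_left] at hyV hyψ
    refine iSup_le fun S ↦ ?_
    have hV1 : (1 : X) ∈ V := mem_of_mem_nhds hV
    have hset : ∀ t, (φ S.1 t ((i x)⁻¹ * i (x * v)) ≠ 1) ↔ r S.1 t x ≠ r S.1 t (x * v) := by
      intro t
      rw [map_mul, map_inv, hφ, hφ, Ne, inv_mul_eq_one]
    simp only [N, hset]
    by_cases hex : ∃ s ∈ S.1, ψ (s⁻¹ * x) ≠ 0 ∨ ψ (s⁻¹ * (x * v)) ≠ 0
    · obtain ⟨s, hs, hsx⟩ := hex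
      have u1 : ∀ x' ∈ S.1, ψ (x'⁻¹ * x) ≠ 0 → x' = s := by
        intro x' hx' h
        rcases hsx with h' | h'
        · exact huniq S x' hx' s hs x 1 hV1 h (by rwa [mul_one])
        · exact huniq S x' hx' s hs x v hyV h h'
      have u2 : ∀ x' ∈ S.1, ψ (x'⁻¹ * (x * v)) ≠ 0 → x' = s := by
        intro x' hx' h
        rcases hsx with h' | h'
        · exact (huniq S s hs x' hx' x v hyV h' h).symm
        · exact huniq S x' hx' s hs (x * v) 1 hV1 h (by rwa [mul_one])
      calc volume {t : ℝ | t ∈ Set.Ico 0 1 ∧ r S.1 t x ≠ r S.1 t (x * v)}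
          ≤ volume (Set.uIcc (ψ (s⁻¹ * x)) (ψ (s⁻¹ * (x * v)))) := by
            refine measure_mono ?_
            rintro t ⟨ht, hne⟩
            rw [r_eq S.1 t s x hs ht.1 u1, r_eq S.1 t s _ hs ht.1 u2] at hne
            rw [Set.mem_uIcc]
            by_cases h1 : t < ψ (s⁻¹ * x) <;> by_cases h2 : t < ψ (s⁻¹ * (x * v))
            · simp [h1, h2] at hne
            · exact Or.inr ⟨not_lt.1 h2, h1.le⟩
            · exact Or.inl ⟨not_lt.1 h1, h2.le⟩
            · simp [h1, h2] at hne
        _ = ENNReal.ofReal |ψ (s⁻¹ * x * v) - ψ (s⁻¹ * x)| := by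
            rw [Real.volume_interval, mul_assoc]
        _ ≤ ε := (ENNReal.ofReal_le_ofReal (hyψ _).le).trans hδε
    · push Not at hex
      refine (measure_mono_null (t := ∅) ?_ measure_empty).trans_le zero_le
      rintro t ⟨ht, hne⟩
      apply hne
      have h1 : ¬ ∃ s ∈ S.1, t < ψ (s⁻¹ * x) := by
        rintro ⟨s, hs, h⟩
        exact absurd ((hex s hs).1 ▸ h) (not_lt.2 ht.1)
      have h2 : ¬ ∃ s ∈ S.1, t < ψ (s⁻¹ * (x * v)) := by
        rintro ⟨s, hs, h⟩
        exact absurd ((hex s hs).2 ▸ h) (not_lt.2 ht.1)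
      simp only [r, dif_neg h1, dif_neg h2]
  · -- The homomorphisms attached to `S` fix the subgroup generated by `S`.
    refine le_trans ?_ (N_le ⟨S, hS⟩ g)
    have hfix : ∀ t ∈ Set.Ico (0 : ℝ) 1, φ S t g = g := by
      intro t ht
      suffices Subgroup.closure (i '' S) ≤ (φ S t).eqLocus (MonoidHom.id G) from this hg
      rw [Subgroup.closure_le]
      rintro _ ⟨x, hx, rfl⟩
      show φ S t (i x) = i x
      rw [hφ, r_eq S t x x hx ht.1, if_pos (by simpa [ψ_one] using ht.2)]
      intro x' hx' h
      exact huniq ⟨S, hS⟩ x' hx' x hx x 1 (mem_of_mem_nhds hV) h (by simp [ψ_one])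
    calc (1 : ENNReal) = volume (Set.Ico (0 : ℝ) 1) := by simp
      _ ≤ _ := measure_mono fun t ht ↦ show t ∈ Set.Ico 0 1 ∧ φ S t g ≠ 1 from
        ⟨ht, by rwa [hfix t ht]⟩

/-- In a Hausdorff group a finite set contains no two points which differ by an element of a
suitable neighborhood of `1`. -/
theorem Finset.exists_nhds_one_separating {T : Type*} [Group T] [TopologicalSpace T] [T1Space T]
    (S : Finset T) : ∃ W ∈ 𝓝 (1 : T), ∀ x ∈ S, ∀ y ∈ S, x ≠ y → x⁻¹ * y ∉ W := by
  classical
  let K : Finset T := ((S ×ˢ S).image fun q ↦ q.1⁻¹ * q.2).erase 1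
  refine ⟨(K : Set T)ᶜ, K.isClosed.isOpen_compl.mem_nhds (by simp [K]), ?_⟩
  intro x hx y hy hxy hmem
  exact hmem (Finset.mem_erase.2 ⟨fun h1 ↦ hxy (inv_mul_eq_one.1 h1), Finset.mem_image.2
    ⟨(x, y), Finset.mem_product.2 ⟨hx, hy⟩, rfl⟩⟩)

namespace FreeGroup

/-- The finite set of letters that occur in the reduced word of `g`. -/
def letters {X : Type*} [DecidableEq X] (g : FreeGroup X) : Finset X :=
  (g.toWord.map Prod.fst).toFinset

theorem mem_closure_letters {X : Type*} [DecidableEq X] (g : FreeGroup X) :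
    g ∈ Subgroup.closure (of '' (letters g : Set X)) := by
  have key : ∀ L : List (X × Bool), (∀ a ∈ L, a.1 ∈ letters g) →
      mk L ∈ Subgroup.closure (of '' (letters g : Set X)) := by
    intro L
    induction L with
    | nil => intro _; exact one_mem _
    | cons a L ih =>
      intro h
      have ha : of a.1 ∈ Subgroup.closure (of '' (letters g : Set X)) :=
        Subgroup.subset_closure ⟨a.1, h a List.mem_cons_self, rfl⟩
      rw [← List.singleton_append, ← mul_mk]
      refine mul_mem ?_ (ih fun b hb ↦ h b (List.mem_cons_of_mem _ hb))
      obtain ⟨x, _ | _⟩ := a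
      · exact inv_mem ha
      · exact ha
  have := key g.toWord fun a ha ↦ List.mem_toFinset.2 (List.mem_map_of_mem ha)
  rwa [mk_toWord] at this

/-- Elements near `1` in the free topological group are trivial or have two distinct letters close
to each other. -/
theorem exists_nhds_one_separated {X : Type*} [Group X] [TopologicalSpace X]
    [IsTopologicalGroup X] {W : Set X} (hW : W ∈ 𝓝 (1 : X)) :
    ∃ O ∈ 𝓝 (1 : FreeGroup X), ∀ g ∈ O, ∀ S : Set X,
      (∀ x ∈ S, ∀ y ∈ S, x ≠ y → x⁻¹ * y ∉ W) → g ∈ Subgroup.closure (of '' S) → g = 1 := by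
  obtain ⟨p, p_one, p_mul, p_inv, p_conj, p_cont, hp⟩ := exists_pseudonorm_separated
    (of : X → FreeGroup X) (fun r ↦ ⟨lift r, fun x ↦ lift_apply_of⟩) hW
  have ht := GroupTopology.tendsto_pseudonorm_coinduced of p p_one p_mul p_inv
    (fun h ε hε ↦ ⟨ε, hε, Set.univ, univ_mem, fun g _ hg ↦ (p_conj h g).trans_lt hg⟩) p_cont
  refine ⟨_, ht (Iio_mem_nhds one_pos), fun g hg S hS hgS ↦ by_contra fun h1 ↦ ?_⟩
  exact absurd hg (not_lt.2 (hp S hS g hgS h1))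

instance {X : Type*} [Group X] [TopologicalSpace X] [IsTopologicalGroup X] [T2Space X] :
    T2Space (FreeGroup X) := by
  classical
  refine IsTopologicalGroup.t2Space_of_one_sep fun g hg ↦ ?_
  obtain ⟨W, hW, hsep⟩ := (letters g).exists_nhds_one_separating
  obtain ⟨O, hO, h⟩ := exists_nhds_one_separated hW
  exact ⟨O, hO, fun hgO ↦ hg (h g hgO (letters g) hsep (mem_closure_letters g))⟩

end FreeGroup

namespace FreeAbelianGroup

/-- Elements near `0` in the free Abelian topological group are trivial or have two distinct letters
close to each other. -/
theorem exists_nhds_zero_separated {X : Type*} [Group X] [TopologicalSpace X]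
    [IsTopologicalGroup X] {W : Set X} (hW : W ∈ 𝓝 (1 : X)) :
    ∃ O ∈ 𝓝 (0 : FreeAbelianGroup X), ∀ g ∈ O, ∀ S : Set X,
      (∀ x ∈ S, ∀ y ∈ S, x ≠ y → x⁻¹ * y ∉ W) → g ∈ AddSubgroup.closure (of '' S) → g = 0 := by
  obtain ⟨p, p_one, p_mul, p_inv, p_conj, p_cont, hp⟩ := exists_pseudonorm_separated
    (fun x : X ↦ Multiplicative.ofAdd (of x))
    (fun r ↦ ⟨AddMonoidHom.toMultiplicative (lift fun x ↦ (r x).toAdd), fun x ↦ by simp⟩) hW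
  have ht := AddGroupTopology.tendsto_pseudonorm_coinduced of
    (fun g ↦ p (Multiplicative.ofAdd g)) p_one (fun g h ↦ p_mul (.ofAdd g) (.ofAdd h))
    (fun g ↦ p_inv (.ofAdd g)) (fun h ε hε ↦ ⟨ε, hε, Set.univ, univ_mem, fun g _ hg ↦
      (p_conj (.ofAdd h) (.ofAdd g)).trans_lt hg⟩) p_cont
  refine ⟨_, ht (Iio_mem_nhds one_pos), fun g hg S hS hgS ↦ by_contra fun h1 ↦ ?_⟩
  refine absurd hg (not_lt.2 (hp S hS (.ofAdd g) ?_ h1))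
  clear hg h1
  induction hgS using AddSubgroup.closure_induction with
  | mem x hx =>
    obtain ⟨s, hs, rfl⟩ := hx
    exact Subgroup.subset_closure ⟨s, hs, rfl⟩
  | zero => exact one_mem _
  | add x y _ _ hx hy => exact mul_mem hx hy
  | neg x _ hx => exact inv_mem hx

theorem mem_closure_support {X : Type*} (g : FreeAbelianGroup X) :
    g ∈ AddSubgroup.closure (of '' (g.support : Set X)) := by
  have h : ∑ x ∈ g.support, coeff x g • of x ∈
      AddSubgroup.closure (of '' (g.support : Set X)) :=
    sum_mem fun x hx ↦ zsmul_mem (AddSubgroup.subset_closure (Set.mem_image_of_mem _ hx)) _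
  rwa [← eq_sum_support_coeff_smul_of g] at h

end FreeAbelianGroup

/-! ### Weakly convergent sequences of integral chains -/

open scoped BoundedContinuousFunction

/-- The space of bounded functions on a topological group that are uniformly continuous for the
left uniformity. -/
def leftUniformBCF (T : Type*) [Group T] [TopologicalSpace T] [IsTopologicalGroup T] :
    Submodule ℝ (T →ᵇ ℝ) where
  carrier := {f | ∀ ε > 0, ∀ᶠ v in 𝓝 (1 : T), ∀ a, |f (a * v) - f a| < ε}
  zero_mem' := fun ε hε ↦ .of_forall fun v a ↦ by simpa using hε
  add_mem' := by
    intro f g hf hg ε hε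
    filter_upwards [hf (ε / 2) (half_pos hε), hg (ε / 2) (half_pos hε)] with v h1 h2 a
    calc |(f + g) (a * v) - (f + g) a| = |(f (a * v) - f a) + (g (a * v) - g a)| := by
          simp only [BoundedContinuousFunction.add_apply]; congr 1; ring
      _ ≤ _ := abs_add_le _ _
      _ < ε / 2 + ε / 2 := add_lt_add (h1 a) (h2 a)
      _ = ε := add_halves ε
  smul_mem' := by
    intro c f hf ε hε
    filter_upwards [hf (ε / (|c| + 1)) (by positivity)] with v h a
    calc |(c • f) (a * v) - (c • f) a| = |c| * |f (a * v) - f a| := by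
          rw [← abs_mul]; simp [mul_sub]
      _ ≤ (|c| + 1) * |f (a * v) - f a| := by gcongr; linarith
      _ < (|c| + 1) * (ε / (|c| + 1)) := by gcongr; exact h a
      _ = ε := by field_simp

theorem isClosed_leftUniformBCF (T : Type*) [Group T] [TopologicalSpace T]
    [IsTopologicalGroup T] : IsClosed (leftUniformBCF T : Set (T →ᵇ ℝ)) := by
  refine isClosed_of_closure_subset fun f hf ε hε ↦ ?_
  obtain ⟨g, hg, hfg⟩ := Metric.mem_closure_iff.1 hf (ε / 3) (by positivity)
  filter_upwards [hg (ε / 3) (by positivity)] with v hv a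
  have h1 : |f (a * v) - g (a * v)| < ε / 3 :=
    (BoundedContinuousFunction.dist_coe_le_dist _).trans_lt hfg
  have h2 : |g a - f a| < ε / 3 := by
    rw [abs_sub_comm]
    exact (BoundedContinuousFunction.dist_coe_le_dist _).trans_lt hfg
  calc |f (a * v) - f a|
      = |(f (a * v) - g (a * v)) + (g (a * v) - g a) + (g a - f a)| := by congr 1; ring
    _ ≤ |f (a * v) - g (a * v)| + |g (a * v) - g a| + |g a - f a| := abs_add_three _ _ _
    _ < ε / 3 + ε / 3 + ε / 3 := by gcongr; exact hv a
    _ = ε := by ring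

instance (T : Type*) [Group T] [TopologicalSpace T] [IsTopologicalGroup T] :
    CompleteSpace (leftUniformBCF T) :=
  (isClosed_leftUniformBCF T).completeSpace_coe

/-- Values in `[-1, 1]` on a finite subset of a Hausdorff group are interpolated in the unit ball
of the space of left uniformly continuous functions. -/
theorem exists_leftUniformBCF_interpolating {T : Type*} [Group T] [TopologicalSpace T]
    [IsTopologicalGroup T] [T2Space T] (S : Finset T) (s : T → ℝ) (hs : ∀ t, |s t| ≤ 1) :
    ∃ f ∈ leftUniformBCF T, ‖f‖ ≤ 1 ∧ ∀ t ∈ S, f t = s t := by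
  obtain ⟨W, hW, hSW⟩ := S.exists_nhds_one_separating
  obtain ⟨ψ, ψ_one, ψ_supp, ψ_unif⟩ := exists_leftUniform_bump hW
  let F : T → ℝ := fun a ↦ ∑ t ∈ S, s t * ψ (t⁻¹ * a)
  have F_unif : ∀ ε > 0, ∀ᶠ v in 𝓝 (1 : T), ∀ a, |F (a * v) - F a| < ε := by
    intro ε hε
    filter_upwards [ψ_unif (ε / (S.card + 1)) (by positivity)] with v hv a
    calc |F (a * v) - F a| = |∑ t ∈ S, s t * (ψ (t⁻¹ * a * v) - ψ (t⁻¹ * a))| := by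
          simp only [F, ← Finset.sum_sub_distrib, mul_sub, mul_assoc]
      _ ≤ ∑ t ∈ S, |s t * (ψ (t⁻¹ * a * v) - ψ (t⁻¹ * a))| := Finset.abs_sum_le_sum_abs _ _
      _ ≤ ∑ t ∈ S, ε / (S.card + 1) := by
          refine Finset.sum_le_sum fun t _ ↦ ?_
          rw [abs_mul, ← one_mul (ε / _)]
          exact mul_le_mul (hs t) (hv _).le (abs_nonneg _) zero_le_one
      _ = S.card * (ε / (S.card + 1)) := by rw [Finset.sum_const, nsmul_eq_mul]
      _ < (S.card + 1) * (ε / (S.card + 1)) := by gcongr; linarith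
      _ = ε := by field_simp
  let c : T → ℝ := fun a ↦ max (-1) (min 1 (F a))
  have c_unif : ∀ ε > 0, ∀ᶠ v in 𝓝 (1 : T), ∀ a, |c (a * v) - c a| < ε := by
    intro ε hε
    filter_upwards [F_unif ε hε] with v hv a
    refine lt_of_le_of_lt ?_ (hv a)
    refine (abs_max_sub_max_le_max _ _ _ _).trans (max_le (by simp) ?_)
    exact (abs_min_sub_min_le_max _ _ _ _).trans (max_le (by simp) le_rfl)
  have c_cont : Continuous c := by
    rw [continuous_iff_continuousAt]
    intro a
    have ht : Tendsto (fun y ↦ a⁻¹ * y) (𝓝 a) (𝓝 1) := by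
      have : Continuous fun y ↦ a⁻¹ * y := by fun_prop
      simpa using this.tendsto a
    rw [ContinuousAt, Metric.tendsto_nhds]
    intro ε hε
    filter_upwards [ht.eventually (c_unif ε hε)] with y hy
    simpa [Real.dist_eq] using hy a
  have c_le : ∀ a, ‖c a‖ ≤ 1 := fun a ↦
    abs_le.2 ⟨le_max_left _ _, max_le (by norm_num) (min_le_left _ _)⟩
  refine ⟨.ofNormedAddCommGroup c c_cont 1 c_le, c_unif,
    BoundedContinuousFunction.norm_ofNormedAddCommGroup_le _ zero_le_one c_le, fun t ht ↦ ?_⟩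
  have hF : F t = s t := by
    show ∑ t' ∈ S, s t' * ψ (t'⁻¹ * t) = s t
    rw [Finset.sum_eq_single_of_mem t ht, inv_mul_cancel, ψ_one, mul_one]
    intro t' ht' hne
    rw [ψ_supp _ (hSW t' ht' t ht hne), mul_zero]
  show max (-1) (min 1 (F t)) = s t
  rw [hF, min_eq_right (abs_le.1 (hs t)).2, max_eq_right (abs_le.1 (hs t)).1]

/-- The Banach–Steinhaus theorem for functionals which tend to zero pointwise on a complete
subspace. -/
theorem Submodule.exists_bound_of_tendsto_zero {E : Type*} [NormedAddCommGroup E]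
    [NormedSpace ℝ E] (p : Submodule ℝ E) [CompleteSpace p] (Λ : ℕ → E →L[ℝ] ℝ)
    (h : ∀ f ∈ p, Tendsto (fun k ↦ Λ k f) atTop (𝓝 0)) :
    ∃ M : ℝ, ∀ k, ∀ f ∈ p, ‖f‖ ≤ 1 → |Λ k f| ≤ M := by
  obtain ⟨M, hM⟩ := banach_steinhaus (g := fun k ↦ (Λ k).comp p.subtypeL) fun f ↦ by
    obtain ⟨C, hC⟩ := (h f.1 f.2).norm.bddAbove_range
    exact ⟨C, fun k ↦ hC ⟨k, rfl⟩⟩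
  refine ⟨M, fun k f hfp hf ↦ (((Λ k).comp p.subtypeL).le_opNorm ⟨f, hfp⟩).trans ?_⟩
  calc ‖(Λ k).comp p.subtypeL‖ * ‖(⟨f, hfp⟩ : p)‖ ≤ M * 1 :=
        mul_le_mul (hM k) hf (norm_nonneg _) ((norm_nonneg _).trans (hM k))
    _ = M := mul_one M

/-- A consequence of the Banach–Steinhaus theorem: integral combinations of point masses which
converge weakly, when tested on left uniformly continuous functions, have bounded total mass. -/
theorem exists_bound_of_weakly_tendsto {T : Type*} [Group T] [TopologicalSpace T]
    [IsTopologicalGroup T] [T2Space T] (D : ℕ → T →₀ ℤ)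
    (hD : ∀ f ∈ leftUniformBCF T,
      Tendsto (fun k ↦ (D k).sum fun t n ↦ (n : ℝ) * f t) atTop (𝓝 0)) :
    ∃ M : ℝ, ∀ k, ∑ t ∈ (D k).support, |(D k t : ℝ)| ≤ M := by
  let Λ : ℕ → (T →ᵇ ℝ) →L[ℝ] ℝ := fun k ↦ ∑ t ∈ (D k).support,
    (D k t : ℝ) • BoundedContinuousFunction.evalCLM ℝ t
  have hΛ : ∀ k f, Λ k f = (D k).sum fun t n ↦ (n : ℝ) * f t := by
    intro k f
    simp [Λ, Finsupp.sum]
  obtain ⟨M, hM⟩ := (leftUniformBCF T).exists_bound_of_tendsto_zero Λ fun f hf ↦ by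
    simp only [hΛ]
    exact hD f hf
  refine ⟨M, fun k ↦ ?_⟩
  obtain ⟨f, hf, hf1, hfS⟩ := exists_leftUniformBCF_interpolating (D k).support
    (fun t ↦ SignType.sign (D k t : ℝ)) fun t ↦ by
      rcases lt_trichotomy (D k t : ℝ) 0 with h | h | h <;> simp [h]
  calc ∑ t ∈ (D k).support, |(D k t : ℝ)| = Λ k f := by
        rw [hΛ]
        refine Finset.sum_congr rfl fun t ht ↦ ?_
        show _ = (D k t : ℝ) * f t
        rw [hfS t ht, self_mul_sign]
    _ ≤ |Λ k f| := le_abs_self _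
    _ ≤ M := hM k f hf hf1

/-! ### Sequences of finite sets accumulating at the identity -/

/-- If the sequences converging to `1` are eventually `1`, then finite sets of bounded cardinality
which do not contain `1` cannot eventually meet each neighborhood of `1`. -/
theorem false_of_finset_tendsto_one {X : Type*} [Group X] [TopologicalSpace X]
    (hX : ∀ u : ℕ → X, Tendsto u atTop (𝓝 1) → ∀ᶠ k in atTop, u k = 1) (N : ℕ)
    (S : ℕ → Finset X) (hcard : ∀ k, (S k).card ≤ N) (hone : ∀ k, 1 ∉ S k)
    (hS : ∀ U ∈ 𝓝 (1 : X), ∀ᶠ k in atTop, ∃ z ∈ S k, z ∈ U) : False := by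
  classical
  induction N generalizing S with
  | zero =>
    obtain ⟨k, z, hz, -⟩ := (hS _ univ_mem).exists
    simp [Finset.card_eq_zero.1 (Nat.le_zero.1 (hcard k))] at hz
  | succ N ih =>
    let z : ℕ → X := fun k ↦ if h : (S k).Nonempty then h.choose else 1
    have hz : ∀ k, (S k).Nonempty → z k ∈ S k := fun k h ↦ by
      simp only [z, dif_pos h]; exact h.choose_spec
    have hne : ∀ᶠ k in atTop, (S k).Nonempty :=
      (hS _ univ_mem).mono fun k ⟨y, hy, _⟩ ↦ ⟨y, hy⟩
    by_cases ht : Tendsto z atTop (𝓝 1)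
    · obtain ⟨k, hk, hk'⟩ := (hne.and (hX z ht)).exists
      exact hone k (hk' ▸ hz k hk)
    -- Along a subsequence the chosen points stay outside `U`, and can be removed.
    · obtain ⟨U, hU, hfreq⟩ : ∃ U ∈ 𝓝 (1 : X), ∃ᶠ k in atTop, z k ∉ U := by
        by_contra! h
        exact ht fun U hU ↦ h U hU
      obtain ⟨σ, hσ, hσ'⟩ := extraction_of_frequently_atTop (hfreq.and_eventually hne)
      refine ih (fun k ↦ (S (σ k)).erase (z (σ k))) (fun k ↦ ?_)
        (fun k h ↦ hone _ (Finset.mem_of_mem_erase h)) fun V hV ↦ ?_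
      · rw [Finset.card_erase_of_mem (hz _ (hσ' k).2)]
        exact Nat.sub_le_iff_le_add.2 (hcard _)
      · filter_upwards [hσ.tendsto_atTop.eventually (hS _ (inter_mem hU hV))] with k ⟨y, hy, hyU⟩
        exact ⟨y, Finset.mem_erase.2 ⟨fun h ↦ (hσ' k).1 (h ▸ hyU.1), hy⟩, hyU.2⟩

/-- If the sequences converging to `1` are eventually `1`, then finite sets of bounded cardinality
cannot contain, for each neighborhood `W` of `1` and eventually, two distinct points that differ by
an element of `W`. -/
theorem false_of_finset_letters_tendsto {X : Type*} [Group X] [TopologicalSpace X]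
    (hX : ∀ u : ℕ → X, Tendsto u atTop (𝓝 1) → ∀ᶠ k in atTop, u k = 1) (N : ℕ)
    (S : ℕ → Finset X) (hcard : ∀ k, (S k).card ≤ N)
    (hS : ∀ W ∈ 𝓝 (1 : X), ∀ᶠ k in atTop, ∃ x ∈ S k, ∃ y ∈ S k, x ≠ y ∧ x⁻¹ * y ∈ W) :
    False := by
  classical
  refine false_of_finset_tendsto_one hX (N * N)
    (fun k ↦ ((S k ×ˢ S k).image fun q ↦ q.1⁻¹ * q.2).erase 1) (fun k ↦ ?_)
    (fun k ↦ Finset.notMem_erase _ _) fun U hU ↦ ?_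
  · refine (Finset.card_erase_le).trans (Finset.card_image_le.trans ?_)
    rw [Finset.card_product]
    exact Nat.mul_le_mul (hcard k) (hcard k)
  · filter_upwards [hS U hU] with k ⟨x, hx, y, hy, hxy, hU⟩
    exact ⟨_, Finset.mem_erase.2 ⟨fun h1 ↦ hxy (inv_mul_eq_one.1 h1), Finset.mem_image.2
      ⟨(x, y), Finset.mem_product.2 ⟨hx, hy⟩, rfl⟩⟩, hU⟩

/-! ### The Fox derivative as a path in the Cayley graph -/

namespace FreeGroup

variable {X : Type*}

/-- The action of the free group by left translation on integral chains of edges of its Cayley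
graph; the pair `(g, x)` stands for the edge from `g` to `g * x`. -/
noncomputable def translate (g : FreeGroup X) :
    (FreeGroup X × X →₀ ℤ) →+ (FreeGroup X × X →₀ ℤ) :=
  Finsupp.mapDomain.addMonoidHom fun q ↦ (g * q.1, q.2)

theorem translate_mul (g h : FreeGroup X) (v : FreeGroup X × X →₀ ℤ) :
    translate (g * h) v = translate g (translate h v) := by
  simp only [translate, Finsupp.mapDomain.addMonoidHom_apply, ← Finsupp.mapDomain_comp]
  congr 1
  ext q <;> simp [mul_assoc]

@[simp] theorem translate_one (v : FreeGroup X × X →₀ ℤ) : translate 1 v = v := by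
  simp only [translate, Finsupp.mapDomain.addMonoidHom_apply, one_mul]
  exact Finsupp.mapDomain_id

@[simp] theorem translate_single (g a : FreeGroup X) (x : X) (n : ℤ) :
    translate g (.single (a, x) n) = .single (g * a, x) n := by
  simp [translate, Finsupp.mapDomain_single]

/-- The affine action of the free group on edge chains whose translation part is the Fox
derivative. -/
noncomputable def foxAffine : FreeGroup X →* Equiv.Perm (FreeGroup X × X →₀ ℤ) :=
  lift fun x ↦
    { toFun := fun v ↦ .single (1, x) 1 + translate (of x) v
      invFun := fun v ↦ translate (of x)⁻¹ (v - .single (1, x) 1)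
      left_inv := fun v ↦ by simp [← translate_mul]
      right_inv := fun v ↦ by
        dsimp only
        rw [← translate_mul, mul_inv_cancel, translate_one, add_sub_cancel] }

/-- The total Fox derivative: the chain of the edge path from `1` to `g` in the Cayley graph of the
free group. -/
noncomputable def fox (g : FreeGroup X) : FreeGroup X × X →₀ ℤ := foxAffine g 0

theorem foxAffine_apply (g : FreeGroup X) (v : FreeGroup X × X →₀ ℤ) :
    foxAffine g v = fox g + translate g v := by
  have hof : ∀ (x : X) (v : FreeGroup X × X →₀ ℤ),
      foxAffine (of x) v = .single (1, x) 1 + translate (of x) v := fun x v ↦ by simp [foxAffine]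
  have hinv : ∀ (x : X) (v : FreeGroup X × X →₀ ℤ),
      foxAffine (of x)⁻¹ v = translate (of x)⁻¹ (v - .single (1, x) 1) := fun x v ↦ by
    simp [foxAffine, Equiv.Perm.inv_def]
  induction g using FreeGroup.induction_on generalizing v with
  | C1 => simp [fox]
  | of x => rw [fox, hof, hof]; simp
  | inv_of x _ => rw [fox, hinv, hinv, ← map_add]; congr 1; abel
  | mul g h hg hh =>
    rw [fox, _root_.map_mul, Equiv.Perm.mul_apply, Equiv.Perm.mul_apply, hh, hg, hg, hh 0,
      translate_mul]
    simp [add_assoc]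

@[simp] theorem fox_one : fox (1 : FreeGroup X) = 0 := by simp [fox]

theorem fox_of (x : X) : fox (of x) = .single (1, x) 1 := by simp [fox, foxAffine]

theorem fox_mul (g h : FreeGroup X) : fox (g * h) = fox g + translate g (fox h) := by
  rw [fox, _root_.map_mul, Equiv.Perm.mul_apply, foxAffine_apply g]
  rfl

theorem fox_inv (g : FreeGroup X) : fox g⁻¹ = -translate g⁻¹ (fox g) := by
  have h := fox_mul g⁻¹ g
  rw [inv_mul_cancel, fox_one] at h
  exact eq_neg_of_add_eq_zero_left h.symm

/-- The path described by a reduced word traverses every edge at most once: both ends of an edge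
traversed by a proper prefix are closer to `1` than one of the ends of the last edge. Hence every
letter of the word labels an edge with nonzero coefficient. -/
theorem fox_mk_of_isReduced [DecidableEq X] (L : List (X × Bool)) (hL : IsReduced L) :
    (∀ q ∈ (fox (mk L)).support, norm q.1 ≤ L.length ∧ norm (q.1 * of q.2) ≤ L.length) ∧
      ∀ a ∈ L, ∃ q ∈ (fox (mk L)).support, q.2 = a.1 := by
  induction L using List.reverseRecOn with
  | nil =>
    have : (mk [] : FreeGroup X) = 1 := rfl
    simp [this]
  | append_singleton L a ih =>
    obtain ⟨h1, h2⟩ := ih (hL.infix (List.prefix_append L [a]).isInfix)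
    have hnorm : norm (mk (L ++ [a])) = (L ++ [a]).length := by
      rw [norm, toWord_mk, hL.reduce_eq]
    have hlen : (L ++ [a]).length = L.length + 1 := by simp
    have hnormL : norm (mk L) ≤ L.length := norm_mk_le
    obtain ⟨e, n, he2, hn, hfox, hle, hle', hnot⟩ : ∃ (e : FreeGroup X × X) (n : ℤ), e.2 = a.1 ∧
        n ≠ 0 ∧ fox (mk (L ++ [a])) = fox (mk L) + .single e n ∧
        norm e.1 ≤ (L ++ [a]).length ∧ norm (e.1 * of e.2) ≤ (L ++ [a]).length ∧
        e ∉ (fox (mk L)).support := by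
      obtain ⟨x, _ | _⟩ := a
      · have hmk : mk (L ++ [(x, false)]) = mk L * (of x)⁻¹ := by rw [← mul_mk]; rfl
        refine ⟨(mk (L ++ [(x, false)]), x), -1, rfl, by norm_num, ?_, hnorm.le, ?_, fun h ↦ ?_⟩
        · simp [hmk, fox_mul, fox_inv, fox_of]
        · simp only [hmk, inv_mul_cancel_right]
          omega
        · have := (h1 _ h).1
          simp only at this
          omega
      · have hmk : mk (L ++ [(x, true)]) = mk L * of x := by rw [← mul_mk]; rfl
        refine ⟨(mk L, x), 1, rfl, by norm_num, ?_, hnormL.trans (by omega), ?_, fun h ↦ ?_⟩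
        · simp [hmk, fox_mul, fox_of]
        · rw [← hmk]; exact hnorm.le
        · have := (h1 _ h).2
          simp only [← hmk] at this
          omega
    have hsupp : (fox (mk (L ++ [a]))).support = insert e (fox (mk L)).support := by
      rw [hfox, Finsupp.support_add_eq, Finsupp.support_single _ hn, Finset.union_comm,
        Finset.insert_eq]
      rw [Finsupp.support_single _ hn]
      simpa using hnot
    rw [hsupp]
    refine ⟨fun q hq ↦ ?_, fun b hb ↦ ?_⟩
    · rcases Finset.mem_insert.1 hq with rfl | hq
      · exact ⟨hle, hle'⟩
      · have := h1 q hq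
        omega
    · rcases List.mem_append.1 hb with hb | hb
      · obtain ⟨q, hq, hqb⟩ := h2 b hb
        exact ⟨q, Finset.mem_insert_of_mem hq, hqb⟩
      · rw [List.mem_singleton.1 hb]
        exact ⟨e, Finset.mem_insert_self _ _, he2⟩

theorem card_letters_le [DecidableEq X] (g : FreeGroup X) :
    (letters g).card ≤ (fox g).support.card := by
  refine (Finset.card_le_card fun x hx ↦ ?_).trans
    (Finset.card_image_le (s := (fox g).support) (f := Prod.snd))
  obtain ⟨a, ha, rfl⟩ := List.mem_map.1 (List.mem_toFinset.1 hx)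
  obtain ⟨q, hq, hqa⟩ := (fox_mk_of_isReduced g.toWord isReduced_toWord).2 a ha
  rw [mk_toWord] at hq
  exact Finset.mem_image.2 ⟨q, hq, hqa⟩

end FreeGroup

/-! ### Continuity of the Fox derivative -/

/-- The pairing of integral chains with real functions. -/
noncomputable def chainPairing {T : Type*} (f : T → ℝ) : (T →₀ ℤ) →+ ℝ :=
  Finsupp.liftAddHom fun t ↦ (AddMonoidHom.mulRight (f t)).comp (Int.castAddHom ℝ)

theorem chainPairing_apply {T : Type*} (f : T → ℝ) (v : T →₀ ℤ) :
    chainPairing f v = v.sum fun t n ↦ (n : ℝ) * f t := rfl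

@[simp] theorem chainPairing_single {T : Type*} (f : T → ℝ) (t : T) (n : ℤ) :
    chainPairing f (.single t n) = n * f t := by
  simp [chainPairing_apply]

namespace FreeGroup

variable {X : Type*} [Group X] [TopologicalSpace X] [IsTopologicalGroup X]

/-- Right multiplication by elements close to `1` moves all translates of an edge chain uniformly
little, since the left uniformity of `F(X) × X` is invariant under left translation. -/
theorem eventually_chainPairing_translate {f : BoundedContinuousFunction (FreeGroup X × X) ℝ}
    (hf : f ∈ leftUniformBCF (FreeGroup X × X)) (v : FreeGroup X × X →₀ ℤ) :
    ∀ ε > 0, ∀ᶠ k in 𝓝 (1 : FreeGroup X), ∀ u,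
      |chainPairing f (translate (u * k) v) - chainPairing f (translate u v)| < ε := by
  induction v using Finsupp.induction_linear with
  | zero => exact fun ε hε ↦ .of_forall fun k u ↦ by simpa using hε
  | add v w hv hw =>
    intro ε hε
    filter_upwards [hv (ε / 2) (half_pos hε), hw (ε / 2) (half_pos hε)] with k h1 h2 u
    calc _ = |(chainPairing f (translate (u * k) v) - chainPairing f (translate u v)) +
            (chainPairing f (translate (u * k) w) - chainPairing f (translate u w))| := by
          simp only [map_add]; congr 1; ring
      _ ≤ _ := abs_add_le _ _
      _ < ε / 2 + ε / 2 := add_lt_add (h1 u) (h2 u)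
      _ = ε := add_halves ε
  | single q n =>
    obtain ⟨a, x⟩ := q
    intro ε hε
    have ht : Tendsto (fun k : FreeGroup X ↦ (a⁻¹ * k * a, (1 : X))) (𝓝 1)
        (𝓝 (1, 1)) := by
      have : Continuous fun k : FreeGroup X ↦ (a⁻¹ * k * a, (1 : X)) := by fun_prop
      simpa using this.tendsto 1
    filter_upwards [ht.eventually (hf (ε / (|(n : ℝ)| + 1)) (by positivity))] with k hk u
    have h := hk (u * a, x)
    have he : (u * a, x) * (a⁻¹ * k * a, 1) = (u * k * a, x) := by
      simp [mul_assoc]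
    rw [he] at h
    rw [translate_single, translate_single, chainPairing_single, chainPairing_single, ← mul_sub,
      abs_mul]
    calc |(n : ℝ)| * |f (u * k * a, x) - f (u * a, x)|
        ≤ (|(n : ℝ)| + 1) * |f (u * k * a, x) - f (u * a, x)| := by gcongr; linarith
      _ < (|(n : ℝ)| + 1) * (ε / (|(n : ℝ)| + 1)) := by gcongr
      _ = ε := by field_simp

/-- The Fox derivative is continuous at `1` when tested on left uniformly continuous functions
of edges. -/
theorem tendsto_chainPairing_fox {f : BoundedContinuousFunction (FreeGroup X × X) ℝ}
    (hf : f ∈ leftUniformBCF (FreeGroup X × X)) :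
    Tendsto (fun g ↦ chainPairing f (fox g)) (𝓝 1) (𝓝 0) := by
  let p : FreeGroup X → ENNReal := fun g ↦ ⨆ u, ‖chainPairing f (translate u (fox g))‖ₑ
  have le_p : ∀ u g, ‖chainPairing f (translate u (fox g))‖ₑ ≤ p g := fun u g ↦
    le_iSup (fun u ↦ ‖chainPairing f (translate u (fox g))‖ₑ) u
  have p_inv_le : ∀ g, p g⁻¹ ≤ p g := fun g ↦ iSup_le fun u ↦ by
    rw [fox_inv, map_neg, map_neg, enorm_neg, ← translate_mul]
    exact le_p _ _
  have hp : Tendsto p (𝓝 1) (𝓝 0) := by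
    refine GroupTopology.tendsto_pseudonorm_coinduced of p (by simp [p]) (fun g h ↦ ?_)
      (fun g ↦ (p_inv_le g).antisymm (by simpa using p_inv_le g⁻¹)) (fun h ε hε ↦ ?_) fun x ↦ ?_
    · refine iSup_le fun u ↦ ?_
      rw [fox_mul, map_add, map_add, ← translate_mul]
      exact (enorm_add_le _ _).trans (add_le_add (le_p _ _) (le_p _ _))
    · obtain ⟨δ, hδ, hδε⟩ := ENNReal.exists_pos_ofReal_le (ENNReal.half_pos hε.ne')
      have hc : Tendsto (fun g ↦ h * g * h⁻¹) (𝓝 1) (𝓝 1) := by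
        have : Continuous fun g : FreeGroup X ↦ h * g * h⁻¹ := by fun_prop
        simpa using this.tendsto 1
      refine ⟨ε / 2, ENNReal.half_pos hε.ne', _,
        hc.eventually (eventually_chainPairing_translate hf (fox h) δ hδ), fun g hg hpg ↦ ?_⟩
      have hfox : fox (h * g * h⁻¹) =
          translate h (fox g) - (translate (h * g * h⁻¹) (fox h) - fox h) := by
        rw [fox_mul, fox_mul, fox_inv, map_neg, ← translate_mul]
        abel
      refine lt_of_le_of_lt (b := p g + ENNReal.ofReal δ) (iSup_le fun u ↦ ?_) ?_
      · rw [hfox, map_sub, map_sub, map_sub, map_sub, ← translate_mul, ← translate_mul]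
        refine enorm_sub_le.trans (add_le_add (le_p _ _) ?_)
        rw [Real.enorm_eq_ofReal_abs]
        exact ENNReal.ofReal_le_ofReal (hg u).le
      · rw [← ENNReal.add_halves ε]
        exact ENNReal.add_lt_add_of_lt_of_le ENNReal.ofReal_ne_top hpg hδε
    · rw [ENNReal.tendsto_nhds_zero]
      intro ε hε
      obtain ⟨δ, hδ, hδε⟩ := ENNReal.exists_pos_ofReal_le hε
      have ht : Tendsto (fun y : X ↦ ((1 : FreeGroup X), x⁻¹ * y)) (𝓝 x) (𝓝 (1, 1)) := by
        have : Continuous fun y : X ↦ ((1 : FreeGroup X), x⁻¹ * y) := by fun_prop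
        simpa using this.tendsto x
      filter_upwards [ht.eventually (hf δ hδ)] with y hy
      refine iSup_le fun u ↦ ?_
      have h := hy (u * (of x)⁻¹, x)
      have he : (u * (of x)⁻¹, x) * (1, x⁻¹ * y) = (u * (of x)⁻¹, y) := by simp
      rw [he] at h
      have hval : chainPairing f (translate u (fox ((of x)⁻¹ * of y))) =
          f (u * (of x)⁻¹, y) - f (u * (of x)⁻¹, x) := by
        rw [fox_mul, fox_inv, fox_of, fox_of]
        simp only [map_add, map_neg, translate_single, chainPairing_single, mul_one]
        push_cast
        ring
      rw [hval, Real.enorm_eq_ofReal_abs]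
      exact (ENNReal.ofReal_le_ofReal h.le).trans hδε
  rw [tendsto_zero_iff_enorm_tendsto_zero]
  refine tendsto_of_tendsto_of_tendsto_of_le_of_le tendsto_const_nhds hp (fun _ ↦ zero_le)
    fun g ↦ ?_
  simpa using le_p 1 g

/-- The elements of a sequence converging to `1` in the free topological group have a bounded
number of letters. -/
theorem exists_card_letters_le [T2Space X] [DecidableEq X] {g : ℕ → FreeGroup X}
    (hg : Tendsto g atTop (𝓝 1)) : ∃ N, ∀ k, (letters (g k)).card ≤ N := by
  obtain ⟨M, hM⟩ := exists_bound_of_weakly_tendsto (fun k ↦ fox (g k))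
    fun f hf ↦ (tendsto_chainPairing_fox hf).comp hg
  refine ⟨⌊M⌋₊, fun k ↦ (card_letters_le (g k)).trans (Nat.le_floor ((hM k).trans' ?_))⟩
  rw [Finset.cast_card]
  refine Finset.sum_le_sum fun t ht ↦ ?_
  exact_mod_cast Int.one_le_abs (Finsupp.mem_support_iff.1 ht)

end FreeGroup

/-! ### Convergent sequences in free topological groups -/

namespace FreeGroup

theorem continuous_of {X : Type*} [TopologicalSpace X] : Continuous (of : X → FreeGroup X) :=
  GroupTopology.coinduced_continuous _

theorem continuous_lift {X G : Type*} [TopologicalSpace X] [Group G] [TopologicalSpace G]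
    [IsTopologicalGroup G] {f : X → G} (hf : Continuous f) : Continuous (lift f) := by
  rw [continuous_iff_le_induced]
  have hle : GroupTopology.coinduced (of : X → FreeGroup X) ≤
      ⟨.induced (lift f) inferInstance, topologicalGroup_induced (lift f)⟩ := by
    refine sInf_le ?_
    show TopologicalSpace.coinduced of _ ≤ TopologicalSpace.induced (lift f) _
    rw [← continuous_iff_coinduced_le, continuous_induced_rng]
    convert hf
    ext x
    simp
  exact hle

/-- Only the trivial sequences converge to `1` in the free topological group over a Hausdorff group
without nontrivial convergent sequences. -/
theorem eventually_eq_one_of_tendsto {X : Type*} [Group X] [TopologicalSpace X]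
    [IsTopologicalGroup X] [T2Space X]
    (hX : ∀ u : ℕ → X, Tendsto u atTop (𝓝 1) → ∀ᶠ k in atTop, u k = 1)
    {g : ℕ → FreeGroup X} (hg : Tendsto g atTop (𝓝 1)) : ∀ᶠ k in atTop, g k = 1 := by
  classical
  by_contra hne
  obtain ⟨σ, hσ, hσ1⟩ := extraction_of_frequently_atTop (not_eventually.1 hne)
  have hgσ := hg.comp hσ.tendsto_atTop
  obtain ⟨N, hN⟩ := exists_card_letters_le hgσ
  refine false_of_finset_letters_tendsto hX N (fun k ↦ letters (g (σ k))) hN fun W hW ↦ ?_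
  obtain ⟨O, hO, h⟩ := exists_nhds_one_separated hW
  filter_upwards [hgσ hO] with k hk
  by_contra! hsep
  exact hσ1 k (h _ hk _ hsep (mem_closure_letters _))

end FreeGroup

namespace FreeAbelianGroup

theorem continuous_of {X : Type*} [TopologicalSpace X] :
    Continuous (of : X → FreeAbelianGroup X) :=
  AddGroupTopology.coinduced_continuous _

theorem continuous_lift {X G : Type*} [TopologicalSpace X] [AddCommGroup G] [TopologicalSpace G]
    [IsTopologicalAddGroup G] {f : X → G} (hf : Continuous f) : Continuous (lift f) := by
  rw [continuous_iff_le_induced]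
  have hle : AddGroupTopology.coinduced (of : X → FreeAbelianGroup X) ≤
      ⟨.induced (lift f) inferInstance, topologicalAddGroup_induced (lift f)⟩ := by
    refine sInf_le ?_
    show TopologicalSpace.coinduced of _ ≤ TopologicalSpace.induced (lift f) _
    rw [← continuous_iff_coinduced_le, continuous_induced_rng]
    convert hf
    ext x
    simp
  exact hle

/-- The elements of a sequence converging to `0` in the free Abelian topological group have bounded
length. -/
theorem exists_sum_abs_coeff_le {X : Type*} [Group X] [TopologicalSpace X]
    [IsTopologicalGroup X] [T2Space X] {g : ℕ → FreeAbelianGroup X}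
    (hg : Tendsto g atTop (𝓝 0)) :
    ∃ M : ℝ, ∀ k, ∑ x ∈ (g k).support, |(coeff x (g k) : ℝ)| ≤ M := by
  refine exists_bound_of_weakly_tendsto (fun k ↦ toFinsupp (g k)) fun f _ ↦ ?_
  have hlift : ∀ a, lift f a = (toFinsupp a).sum fun t n ↦ (n : ℝ) * f t := fun a ↦ by
    rw [← chainPairing_apply]
    refine lift_ext (lift f) ((chainPairing f).comp toFinsupp) (fun x ↦ ?_) ▸ rfl
    simp
  have h := ((continuous_lift f.continuous).tendsto 0).comp hg
  simpa only [Function.comp_def, hlift, map_zero, Finsupp.sum_zero_index] using h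

theorem card_support_le_sum {X : Type*} (a : FreeAbelianGroup X) :
    (a.support.card : ℝ) ≤ ∑ x ∈ a.support, |(coeff x a : ℝ)| := by
  rw [Finset.cast_card]
  refine Finset.sum_le_sum fun x hx ↦ ?_
  exact_mod_cast Int.one_le_abs ((mem_support_iff x a).1 hx)

/-- Only the trivial sequences converge to `0` in the free Abelian topological group over a
Hausdorff group without nontrivial convergent sequences. -/
theorem eventually_eq_zero_of_tendsto {X : Type*} [Group X] [TopologicalSpace X]
    [IsTopologicalGroup X] [T2Space X]
    (hX : ∀ u : ℕ → X, Tendsto u atTop (𝓝 1) → ∀ᶠ k in atTop, u k = 1)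
    {g : ℕ → FreeAbelianGroup X} (hg : Tendsto g atTop (𝓝 0)) : ∀ᶠ k in atTop, g k = 0 := by
  by_contra hne
  obtain ⟨σ, hσ, hσ1⟩ := extraction_of_frequently_atTop (not_eventually.1 hne)
  have hgσ := hg.comp hσ.tendsto_atTop
  obtain ⟨M, hM⟩ := exists_sum_abs_coeff_le hgσ
  refine false_of_finset_letters_tendsto hX ⌊M⌋₊ (fun k ↦ (g (σ k)).support)
    (fun k ↦ Nat.le_floor ((card_support_le_sum _).trans (hM k))) fun W hW ↦ ?_
  obtain ⟨O, hO, h⟩ := exists_nhds_zero_separated hW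
  filter_upwards [hgσ hO] with k hk
  by_contra! hsep
  exact hσ1 k (h _ hk _ hsep (mem_closure_support _))

end FreeAbelianGroup

theorem eventually_eq_of_tendsto {Y : Type*} [TopologicalSpace Y] [T2Space Y]
    (hY : ¬ HasNontrivialConvergentSequence Y) {u : ℕ → Y} {x : Y}
    (hu : Tendsto u atTop (𝓝 x)) : ∀ᶠ n in atTop, u n = x := by
  obtain ⟨c, hc⟩ : ∃ c : Y, ∀ᶠ n in atTop, u n = c := by
    by_contra h
    exact hY ⟨u, x, hu, h⟩
  have hcx : c = x := tendsto_nhds_unique (tendsto_const_nhds.congr' (hc.mono fun _ h ↦ h.symm)) hu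
  rwa [hcx] at hc

/-! ### Diagonal sequences in `snf`-countable spaces -/

/-- If only the trivial sequences converge, every singleton is a sequential neighborhood. -/
theorem snfCountable_of_forall_eventually_eq {Y : Type*} [TopologicalSpace Y]
    (hY : ∀ (u : ℕ → Y) (x : Y), Tendsto u atTop (𝓝 x) → ∀ᶠ n in atTop, u n = x) :
    SnfCountable Y := by
  refine ⟨fun x ↦ {{x}}, ⟨?_, ?_, ?_, ?_⟩, fun x ↦ Set.countable_singleton _⟩
  · refine Set.eq_univ_of_forall fun x ↦ ?_
    exact ⟨{x}, Set.mem_iUnion.2 ⟨x, rfl⟩, rfl⟩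
  · rintro x _ rfl _ rfl
    exact ⟨{x}, rfl, fun y hy ↦ ⟨hy, hy⟩⟩
  · intro x U _ hx
    exact ⟨{x}, rfl, rfl, Set.singleton_subset_iff.2 hx⟩
  · rintro x _ rfl u hu
    exact hY u x hu

/-- In an `snf`-countable space, countably many sequences with the same limit `y` have a diagonal
sequence which converges to `y`. -/
theorem SnfCountable.exists_diagonal_tendsto {Y : Type*} [TopologicalSpace Y]
    (hY : SnfCountable Y) {y : Y} {s : ℕ → ℕ → Y} (hs : ∀ m, Tendsto (s m) atTop (𝓝 y))
    {Q : ℕ → Prop} (hQ : ∃ᶠ k in atTop, Q k) :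
    ∃ κ : ℕ → ℕ, (∀ m, Q (κ m)) ∧ Tendsto (fun m ↦ s m (κ m)) atTop (𝓝 y) := by
  obtain ⟨N, hN, hcount⟩ := hY
  obtain ⟨P₀, hP₀, -⟩ := hN.network y Set.univ isOpen_univ trivial
  obtain ⟨P, hP⟩ := (hcount y).exists_eq_range ⟨P₀, hP₀⟩
  have hmem : ∀ n, P n ∈ N y := fun n ↦ hP ▸ Set.mem_range_self n
  have hex : ∀ m, ∃ k, Q k ∧ ∀ n ≤ m, s m k ∈ P n := fun m ↦ by
    have h : ∀ᶠ k in atTop, ∀ n ∈ Set.Iic m, s m k ∈ P n :=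
      (eventually_all_finite (Set.finite_Iic m)).2
        fun n _ ↦ hN.sequentialNhd y _ (hmem n) _ (hs m)
    exact (hQ.and_eventually h).exists
  choose κ hκQ hκ using hex
  refine ⟨κ, hκQ, ?_⟩
  rw [(nhds_basis_opens y).tendsto_right_iff]
  rintro U ⟨hyU, hU⟩
  obtain ⟨R, hR, -, hRU⟩ := hN.network y U hU hyU
  obtain ⟨n, rfl⟩ : R ∈ Set.range P := hP ▸ hR
  filter_upwards [eventually_ge_atTop n] with m hm
  exact hRU (hκ m n hm)

theorem HasNontrivialConvergentSequence.exists_frequently_ne {Y : Type*} [TopologicalSpace Y]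
    (hY : HasNontrivialConvergentSequence Y) :
    ∃ (u : ℕ → Y) (x : Y), Tendsto u atTop (𝓝 x) ∧ ∃ᶠ n in atTop, u n ≠ x := by
  obtain ⟨u, x, hu, hne⟩ := hY
  exact ⟨u, x, hu, fun h ↦ hne ⟨x, h.mono fun _ h ↦ not_not.1 h⟩⟩

/-- Multiples `m • (u k - x)` of unbounded length do not converge to `0`. -/
theorem FreeAbelianGroup.not_tendsto_nsmul_sub {X : Type*} [Group X] [TopologicalSpace X]
    [IsTopologicalGroup X] [T2Space X] {u : ℕ → X} {x : X} (hu : ∀ m, u m ≠ x) :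
    ¬ Tendsto (fun m : ℕ ↦ m • (of (u m) - of x)) atTop (𝓝 0) := by
  intro h
  obtain ⟨M, hM⟩ := exists_sum_abs_coeff_le h
  obtain ⟨m, hm⟩ := exists_nat_gt (max M 0)
  have hcoeff : coeff (u m) (m • (of (u m) - of x)) = m := by
    rw [map_nsmul, map_sub]
    simp [coeff, (hu m).symm]
  have hm0 : m ≠ 0 := by
    rintro rfl
    exact absurd hm (by simp)
  have hmem : u m ∈ (m • (of (u m) - of x)).support := by
    rw [mem_support_iff, hcoeff]
    exact_mod_cast hm0
  have h1 := (Finset.single_le_sum (f := fun t ↦ |(coeff t (m • (of (u m) - of x)) : ℝ)|)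
    (fun _ _ ↦ abs_nonneg _) hmem).trans (hM m)
  rw [hcoeff] at h1
  have h2 : (m : ℝ) ≤ M := by simpa using h1
  exact absurd ((le_max_left M 0).trans_lt hm) (not_lt.2 h2)

/-- A nontrivial convergent sequence in `X` gives rise to sequences `k ↦ m • (u k - x)`, one for
each `m`, which converge to `0` in the free Abelian topological group without admitting a
convergent diagonal sequence. -/
theorem FreeAbelianGroup.not_snfCountable {X : Type*} [Group X] [TopologicalSpace X]
    [IsTopologicalGroup X] [T2Space X] (hX : HasNontrivialConvergentSequence X) :
    ¬ SnfCountable (FreeAbelianGroup X) := by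
  intro hsnf
  obtain ⟨u, x, hu, hne⟩ := hX.exists_frequently_ne
  obtain ⟨κ, hκ, h⟩ := hsnf.exists_diagonal_tendsto (y := 0)
    (s := fun m k ↦ m • (of (u k) - of x)) (fun m ↦ by
      have hc : Continuous fun y : X ↦ m • (of y - of x) :=
        continuous_const_smul m |>.comp (by have := continuous_of (X := X); fun_prop)
      simpa [Function.comp_def] using (hc.tendsto x).comp hu) hne
  exact not_tendsto_nsmul_sub hκ h

theorem FreeGroup.not_snfCountable {X : Type*} [Group X] [TopologicalSpace X]
    [IsTopologicalGroup X] [T2Space X] (hX : HasNontrivialConvergentSequence X) :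
    ¬ SnfCountable (FreeGroup X) := by
  intro hsnf
  obtain ⟨u, x, hu, hne⟩ := hX.exists_frequently_ne
  obtain ⟨κ, hκ, h⟩ := hsnf.exists_diagonal_tendsto (y := 1)
    (s := fun m k ↦ (of (u k) * (of x)⁻¹) ^ m) (fun m ↦ by
      have hc : Continuous fun y : X ↦ (of y * (of x)⁻¹) ^ m :=
        (continuous_of.mul continuous_const).pow m
      simpa [Function.comp_def] using (hc.tendsto x).comp hu) hne
  let φ : FreeGroup X →* Multiplicative (FreeAbelianGroup X) :=
    lift fun y ↦ .ofAdd (FreeAbelianGroup.of y)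
  have hφ : Continuous φ := continuous_lift (continuous_ofAdd.comp FreeAbelianGroup.continuous_of)
  refine FreeAbelianGroup.not_tendsto_nsmul_sub hκ ?_
  have h' := (continuous_toAdd.tendsto _).comp ((hφ.tendsto 1).comp h)
  simpa [Function.comp_def, φ, sub_eq_add_neg] using h'

theorem theorem3p3 (X : Type*) [Group X] [TopologicalSpace X] [IsTopologicalGroup X] [T2Space X] :
    (SnfCountable (FreeGroup X) ↔ ¬ HasNontrivialConvergentSequence X) ∧
      (SnfCountable (FreeAbelianGroup X) ↔ ¬ HasNontrivialConvergentSequence X) := by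
  refine ⟨⟨fun h hX ↦ FreeGroup.not_snfCountable hX h, fun hX ↦ ?_⟩,
    ⟨fun h hX ↦ FreeAbelianGroup.not_snfCountable hX h, fun hX ↦ ?_⟩⟩
  · refine snfCountable_of_forall_eventually_eq fun u x hu ↦ ?_
    have h : Tendsto (fun n ↦ x⁻¹ * u n) atTop (𝓝 1) := by
      simpa using hu.const_mul x⁻¹
    refine (FreeGroup.eventually_eq_one_of_tendsto (fun v hv ↦ eventually_eq_of_tendsto hX hv)
      h).mono fun n hn ↦ ?_
    exact (inv_mul_eq_one.1 hn).symm
  · refine snfCountable_of_forall_eventually_eq fun u x hu ↦ ?_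
    have h : Tendsto (fun n ↦ u n - x) atTop (𝓝 0) := by
      simpa using hu.sub_const x
    exact (FreeAbelianGroup.eventually_eq_zero_of_tendsto
      (fun v hv ↦ eventually_eq_of_tendsto hX hv) h).mono fun n hn ↦ sub_eq_zero.1 hn
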